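/- Let $N\ge 2$ sensors move in $\mathbb{R}^2$; let $\mathbf{x}=(x_1,\dots,x_N)$, $x_i\in\mathbb{R}^2$. Sensor $i$ has the cost $$f_i(\mathbf{x})=x_i^Tr_{ii}x_i+x_i^Tr_i+b_i+\sum_{j\in\mathcal{N}_i^p}c_{ij}\|x_i-x_j\|^2,$$ where $r_{ii}\in\mathbb{R}^{2\times2}$ is symmetric positive definite and strictly diagonally dominant, $r_i\in\mathbb{R}^2$, $b_i\in\mathbb{R}$, $\mathcal{N}_i^p\subseteq\{1,\dots,N\}$ is the set of physical neighbors of $i$, and $c_{ij}>0$ for $j\in\mathcal{N}_i^p$. Let $a_{ij}=a_{ji}\ge 0$, $a_{ii}=0$, be the adjacency weights of a connected undirected communication graph (with an edge between $i$ and $j$ exactly if $a_{ij}>0$). Let $t_0\in\mathbb{R}$, and let the disturbances $d_i:[t_0,\infty)\to\mathbb{R}^2$ be continuously differentiable with bounded derivative. Let $\bar\theta_{ij},k_{i1},k_{i2}$ be fixed positive constants. For gains $\theta,\sigma>0$, consider for $t\ge t_0$ the closed loop $$\dot x_i=u_i+d_i(t),\qquad u_i=-\frac{\partial f_i}{\partial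 x_i}(\mathbf{y}_i)-\hat z_i,\qquad \mathbf{y}_i=(y_{i1},\dots,y_{iN}),$$ $$\dot y_{ij}=-\theta\bar\theta_{ij}\Big(\sum_{k=1}^N a_{ik}(y_{ij}-y_{kj})+a_{ij}(y_{ij}-x_j)\Big),$$ $$\dot{\hat x}_i=u_i+\hat z_i+\sigma k_{i1}(x_i-\hat x_i),\qquad \dot{\hat z}_i=\sigma^2k_{i2}(x_i-\hat x_i),$$ with all variables $x_i,y_{ij},\hat x_i,\hat z_i$ in $\mathbb{R}^2$ and with arbitrary initial values. Then the game has a unique Nash equilibrium $\mathbf{x}^*$, that is, a unique profile with $f_i(\mathbf{x}^*)\le f_i(x_i,\mathbf{x}^*_{-i})$ for all $i$ and all $x_i\in\mathbb{R}^2$. Let $\mathcal{E}(t)$ be the concatenation of all the vectors $x_i-\hat x_i$, $d_i(t)-\hat z_i$, $y_{ij}-x_j$ and $x_i-x_i^*$ at time $t$, with the Euclidean norm. There is a constant $\theta^*>0$ such that for every $v_1>0$ there is a constant $\sigma^*=\sigma^*(v_1)>0$, neither of them depending on the initial values, such that for all $\theta\in(\theta^*,\infty)$ and $\sigma\in(\sigma^*,\infty)$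 and every solution of the closed loop on $[t_0,\infty)$ there is a $\bar T\ge t_0$ with $$\|\mathcal{E}(t)\|\le v_1\qquad\text{for all } t>\bar T.$$ -/

import Mathlib

/-- The plane `ℝ²` with the Euclidean norm, in which the sensors move. -/
abbrev Plane : Type := EuclideanSpace ℝ (Fin 2)

/-- The data of the mobile-sensor connectivity game with `N` sensors: the local cost
`x_iᵀ r_ii x_i + x_iᵀ r_i + b_i` of each sensor, its set of physical neighbours, and the positive
weights `c_ij` of the coupling costs `c_ij ‖x_i - x_j‖²`. -/
structure SensorGame (N : ℕ) where
  /-- the matrices `r_ii` -/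
  quad : Fin N → Matrix (Fin 2) (Fin 2) ℝ
  /-- the vectors `r_i` -/
  lin : Fin N → Plane
  /-- the constants `b_i` -/
  const : Fin N → ℝ
  /-- the physical neighbour sets -/
  physNbr : Fin N → Finset (Fin N)
  /-- the coupling weights `c_ij` -/
  c : Fin N → Fin N → ℝ
  /-- each `r_ii` is symmetric positive definite -/
  quad_posDef : ∀ i, (quad i).PosDef
  /-- each `r_ii` is strictly diagonally dominant -/
  quad_diagDom : ∀ i k, ∑ l ∈ Finset.univ.erase k, |quad i k l| < |quad i k k|
  c_pos : ∀ i, ∀ j ∈ physNbr i, 0 < c i j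

/-- A weighted undirected communication graph on `N` nodes, given by its adjacency matrix: there
is an edge between `i` and `j` exactly if `a i j > 0`. -/
structure CommGraph (N : ℕ) where
  a : Fin N → Fin N → ℝ
  nonneg : ∀ i j, 0 ≤ a i j
  symm : ∀ i j, a i j = a j i
  diag : ∀ i, a i i = 0

/-- The underlying simple graph of a weighted communication graph. -/
def CommGraph.toSimpleGraph {N : ℕ} (A : CommGraph N) : SimpleGraph (Fin N) where
  Adj i j := 0 < A.a i j
  symm := ⟨fun i j h => by rw [A.symm j i]; exact h⟩
  loopless := ⟨fun i h => by rw [A.diag i] at h; exact lt_irrefl _ h⟩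

/-- The fixed positive parameters of the strategy. -/
structure FixedGains (N : ℕ) where
  thetaBar : Fin N → Fin N → ℝ
  k₁ : Fin N → ℝ
  k₂ : Fin N → ℝ
  thetaBar_pos : ∀ i j, 0 < thetaBar i j
  k₁_pos : ∀ i, 0 < k₁ i
  k₂_pos : ∀ i, 0 < k₂ i

namespace SensorGame

variable {N : ℕ}

/-- The local cost `l_i^c(v) = vᵀ r_ii v + vᵀ r_i + b_i`. -/
noncomputable def localCost (G : SensorGame N) (i : Fin N) (v : Plane) : ℝ :=
  (∑ k, ∑ l, v k * G.quad i k l * v l) + (∑ k, v k * G.lin i k) + G.const i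

/-- The cost `f_i` of sensor `i`. -/
noncomputable def cost (G : SensorGame N) (i : Fin N) (x : Fin N → Plane) : ℝ :=
  G.localCost i (x i) + ∑ j ∈ G.physNbr i, G.c i j * ‖x i - x j‖ ^ 2

/-- The partial gradient `∂f_i/∂x_i`, a vector of `ℝ²`, at the profile `x`. -/
noncomputable def partialGrad (G : SensorGame N) (i : Fin N) (x : Fin N → Plane) : Plane :=
  gradient (fun v : Plane => G.cost i (Function.update x i v)) (x i)

/-- `x` is a Nash equilibrium: no sensor lowers its cost by changing its own position only. -/
def IsNash (G : SensorGame N) (x : Fin N → Plane) : Prop :=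
  ∀ (i : Fin N) (v : Plane), G.cost i x ≤ G.cost i (Function.update x i v)

end SensorGame

/-- The state of the closed loop: positions `x_i`, observer states `x̂_i` and `ẑ_i`, and the
estimates `y_ij` by sensor `i` of the position of sensor `j`. -/
structure LoopState (N : ℕ) where
  x : Fin N → Plane
  xhat : Fin N → Plane
  zhat : Fin N → Plane
  y : Fin N → Fin N → Plane

/-- The control law `u_i = -∂f_i/∂x_i(y_i) - ẑ_i`. -/
noncomputable def piControl {N : ℕ} (G : SensorGame N) (S : LoopState N) (i : Fin N) : Plane :=
  -G.partialGrad i (S.y i) - S.zhat i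

/-- `S` solves the closed loop of `ẋ_i = u_i + d_i(t)` with the PI-based strategy with gains
`θ`, `σ` on `[t₀, ∞)`, from arbitrary initial values. -/
structure IsTrajectory {N : ℕ} (G : SensorGame N) (A : CommGraph N) (K : FixedGains N)
    (d : Fin N → ℝ → Plane) (t₀ θ σ : ℝ) (S : ℝ → LoopState N) : Prop where
  x_eq : ∀ t, t₀ ≤ t → ∀ i,
    HasDerivWithinAt (fun s => (S s).x i) (piControl G (S t) i + d i t) (Set.Ici t₀) t
  y_eq : ∀ t, t₀ ≤ t → ∀ i j,
    HasDerivWithinAt (fun s => (S s).y i j)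
      (-((θ * K.thetaBar i j) •
        ((∑ k, A.a i k • ((S t).y i j - (S t).y k j)) + A.a i j • ((S t).y i j - (S t).x j))))
      (Set.Ici t₀) t
  xhat_eq : ∀ t, t₀ ≤ t → ∀ i,
    HasDerivWithinAt (fun s => (S s).xhat i)
      (piControl G (S t) i + (S t).zhat i + (σ * K.k₁ i) • ((S t).x i - (S t).xhat i))
      (Set.Ici t₀) t
  zhat_eq : ∀ t, t₀ ≤ t → ∀ i,
    HasDerivWithinAt (fun s => (S s).zhat i)
      ((σ ^ 2 * K.k₂ i) • ((S t).x i - (S t).xhat i)) (Set.Ici t₀) t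

/-- The concatenated error vector, with the Euclidean norm. Its blocks, each in `ℝ²`, are
`ζ_i1 = x_i - x̂_i`, `ζ_i2 = d_i(t) - ẑ_i`, `η_ij = y_ij - x_j` and `ξ_i = x_i - x_i^*`. -/
noncomputable def errorVec {N : ℕ} (xs : Fin N → Plane) (d : Fin N → ℝ → Plane)
    (S : ℝ → LoopState N) (t : ℝ) :
    PiLp 2 (fun _ : (Fin N ⊕ Fin N) ⊕ (Fin N × Fin N) ⊕ Fin N => Plane) :=
  WithLp.toLp 2
    (Sum.elim
      (Sum.elim (fun i => (S t).x i - (S t).xhat i) (fun i => d i t - (S t).zhat i))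
      (Sum.elim (fun p => (S t).y p.1 p.2 - (S t).x p.2) (fun i => (S t).x i - xs i)))

/-! The costs are quadratic and convex in the own position, so Nash equilibria are the zeros of the
affine map `x ↦ (hess i x + lin i)_i`. The weights `c_ij` need not be symmetric, so this map need
not be monotone for the plain inner product. Its comparison matrix, however, is a nonsingular
M-matrix, and suitable positive weights `w` on the sensors make it strongly monotone
(`exists_pos_weights`, `exists_weights`). This gives existence and uniqueness of the equilibrium,
and decay of `∑ w_i ‖ξ_i‖²`.

In the errors `ξ = x - x*`, `η_ij = y_ij - x_j`, `p = σ(x - x̂)`, `q = d - ẑ`, the loop consists of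
three coupled linear systems. The estimation error is damped at rate `θ` by the pinned Laplacian,
which is positive definite on a connected graph (`exists_pinnedLap_coercive`). The scaled observer
error is damped at rate `σ`, and the derivative of the disturbance enters only as `O(1/σ)`
(`obsLyapDeriv_le`).

Young's inequality bounds the cross terms; large `θ` absorbs those in `η`, large `σ` those in `q`.
The sum `U` of the three Lyapunov functions then satisfies `U' ≤ -U/B + D/σ`
(`exists_loopLyapDeriv_le`, `exists_loopLyap_le`), so `U` ends up below any level above `BD/σ`. The
accuracy `v₁` therefore constrains `σ` only. -/

open scoped RealInnerProductSpace
open Finset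

/-! ### Quadratic costs, their gradients and the Nash condition -/

namespace SensorGame

variable {N : ℕ} (G : SensorGame N)

/-- The coupling weights, extended by zero to all pairs of sensors. -/
noncomputable def coupling (i j : Fin N) : ℝ := if j ∈ G.physNbr i then G.c i j else 0

theorem coupling_nonneg (i j : Fin N) : 0 ≤ G.coupling i j := by
  unfold coupling
  split_ifs with h
  · exact (G.c_pos i j h).le
  · exact le_rfl

/-- The operator `v ↦ r_ii v` on the plane. -/
noncomputable def quadLin (i : Fin N) : Plane →ₗ[ℝ] Plane := Matrix.toEuclideanLin (G.quad i)

theorem quadLin_symm (i : Fin N) (v w : Plane) : ⟪G.quadLin i v, w⟫ = ⟪v, G.quadLin i w⟫ :=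
  (Matrix.isSymmetric_toEuclideanLin_iff.2 (G.quad_posDef i).isHermitian) v w

theorem inner_quadLin (i : Fin N) (v : Plane) :
    ⟪v, G.quadLin i v⟫ = ∑ k, ∑ l, v k * G.quad i k l * v l := by
  simp only [quadLin, PiLp.inner_apply, Matrix.toLpLin_apply, Fin.sum_univ_two,
    Matrix.mulVec, dotProduct, RCLike.inner_apply, conj_trivial]
  ring

theorem inner_quadLin_pos (i : Fin N) {v : Plane} (hv : v ≠ 0) : 0 < ⟪v, G.quadLin i v⟫ := by
  have h := (G.quad_posDef i).dotProduct_mulVec_pos (x := WithLp.ofLp v) (by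
    intro h; exact hv (by ext k; exact congrFun h k))
  rw [inner_quadLin]
  simp only [Fin.sum_univ_two, Matrix.mulVec, dotProduct, Pi.star_apply, star_trivial] at h ⊢
  linarith

theorem localCost_eq (i : Fin N) (v : Plane) :
    G.localCost i v = ⟪v, G.quadLin i v⟫ + ⟪v, G.lin i⟫ + G.const i := by
  rw [localCost, inner_quadLin]
  simp only [PiLp.inner_apply, RCLike.inner_apply, conj_trivial, Fin.sum_univ_two]
  ring

/-- The linear part of the partial gradient of the cost of sensor `i`. -/
noncomputable def hess (i : Fin N) : (Fin N → Plane) →ₗ[ℝ] Plane :=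
  (2 : ℝ) • (G.quadLin i ∘ₗ LinearMap.proj i) +
    ∑ j, (2 * G.coupling i j) •
      ((LinearMap.proj i : (Fin N → Plane) →ₗ[ℝ] Plane) - LinearMap.proj j)

theorem hess_apply (i : Fin N) (z : Fin N → Plane) :
    G.hess i z = (2 : ℝ) • G.quadLin i (z i) + ∑ j, (2 * G.coupling i j) • (z i - z j) := by
  simp [hess]

/-- The second-order part of the cost of sensor `i` as a function of its own position. -/
noncomputable def ownQuad (i : Fin N) (h : Plane) : ℝ :=
  ⟪h, G.quadLin i h⟫ + (∑ j ∈ (G.physNbr i).erase i, G.c i j) * ‖h‖ ^ 2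

theorem ownQuad_nonneg (i : Fin N) (h : Plane) : 0 ≤ G.ownQuad i h := by
  have h1 : 0 ≤ ⟪h, G.quadLin i h⟫ := by
    rcases eq_or_ne h 0 with rfl | hh
    · simp
    · exact (G.inner_quadLin_pos i hh).le
  have h2 : 0 ≤ ∑ j ∈ (G.physNbr i).erase i, G.c i j :=
    Finset.sum_nonneg fun j hj => (G.c_pos i j (Finset.mem_of_mem_erase hj)).le
  unfold ownQuad
  positivity

/-- Exact second-order Taylor expansion in the own position; both the gradient and the Nash
criterion are read off from it. -/
theorem cost_update_add (i : Fin N) (x : Fin N → Plane) (h : Plane) :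
    G.cost i (Function.update x i (x i + h)) =
      G.cost i x + ⟪G.hess i x + G.lin i, h⟫ + G.ownQuad i h := by
  have hsum : ∑ j ∈ G.physNbr i, G.c i j *
        ‖Function.update x i (x i + h) i - Function.update x i (x i + h) j‖ ^ 2 =
      ∑ j ∈ G.physNbr i, G.c i j * ‖x i - x j‖ ^ 2 +
        ⟪∑ j, (2 * G.coupling i j) • (x i - x j), h⟫ +
        (∑ j ∈ (G.physNbr i).erase i, G.c i j) * ‖h‖ ^ 2 := by
    have e1 : ⟪∑ j, (2 * G.coupling i j) • (x i - x j), h⟫ =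
        ∑ j ∈ G.physNbr i, 2 * G.c i j * ⟪x i - x j, h⟫ := by
      rw [sum_inner, ← Finset.sum_filter_add_sum_filter_not Finset.univ (· ∈ G.physNbr i)]
      have z : ∑ j with ¬ j ∈ G.physNbr i, ⟪(2 * G.coupling i j) • (x i - x j), h⟫ = 0 := by
        refine Finset.sum_eq_zero fun j hj => ?_
        simp [coupling, (Finset.mem_filter.1 hj).2]
      rw [z, add_zero]
      have : (Finset.univ.filter (· ∈ G.physNbr i)) = G.physNbr i := by ext; simp
      rw [this]
      refine Finset.sum_congr rfl fun j hj => ?_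
      simp [coupling, hj, real_inner_smul_left]
    -- A sensor may be listed as its own neighbour; that term stays zero under the update, hence the
    -- `erase i`.
    have e2 : (∑ j ∈ (G.physNbr i).erase i, G.c i j) * ‖h‖ ^ 2 =
        ∑ j ∈ G.physNbr i, if j = i then 0 else G.c i j * ‖h‖ ^ 2 := by
      rw [Finset.sum_mul, Finset.sum_ite, Finset.sum_const_zero, zero_add]
      congr 1
      ext j
      simp [and_comm]
    rw [e1, e2, ← Finset.sum_add_distrib, ← Finset.sum_add_distrib]
    refine Finset.sum_congr rfl fun j _ => ?_
    rcases eq_or_ne j i with rfl | hj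
    · simp
    · rw [if_neg hj, Function.update_self, Function.update_of_ne hj, add_sub_right_comm,
        norm_add_sq_real]
      ring
  have hs : ⟪h, G.quadLin i (x i)⟫ = ⟪x i, G.quadLin i h⟫ := by
    rw [← quadLin_symm, real_inner_comm]
  rw [cost, hsum, cost, Function.update_self, localCost_eq, localCost_eq, hess_apply, ownQuad]
  simp only [map_add, inner_add_left, inner_add_right, real_inner_smul_left, hs, quadLin_symm]
  rw [real_inner_comm h (G.lin i)]
  ring

theorem ownQuad_isBigO (i : Fin N) (a : Plane) :
    (fun v => G.ownQuad i (v - a)) =O[nhds a] fun v => ‖v - a‖ ^ 2 := by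
  refine Asymptotics.IsBigO.of_bound
    (‖LinearMap.toContinuousLinearMap (G.quadLin i)‖ + |∑ j ∈ (G.physNbr i).erase i, G.c i j|)
    (Filter.Eventually.of_forall fun v => ?_)
  set h := v - a
  have h1 := (LinearMap.toContinuousLinearMap (G.quadLin i)).le_opNorm h
  have h2 : |⟪h, G.quadLin i h⟫| ≤ ‖h‖ * ‖G.quadLin i h‖ := abs_real_inner_le_norm _ _
  rw [LinearMap.coe_toContinuousLinearMap'] at h1
  rw [Real.norm_eq_abs, ownQuad, norm_pow, norm_norm]
  calc _ ≤ |⟪h, G.quadLin i h⟫| + |(∑ j ∈ (G.physNbr i).erase i, G.c i j) * ‖h‖ ^ 2| :=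
        abs_add_le _ _
    _ ≤ _ := by
        rw [abs_mul, abs_of_nonneg (sq_nonneg ‖h‖)]
        nlinarith [mul_le_mul_of_nonneg_left h1 (norm_nonneg h)]

theorem hasGradientAt_cost (i : Fin N) (x : Fin N → Plane) :
    HasGradientAt (fun v : Plane => G.cost i (Function.update x i v)) (G.hess i x + G.lin i)
      (x i) := by
  have e : (fun v : Plane => G.cost i (Function.update x i v)) =
      fun v => (G.cost i x + ⟪G.hess i x + G.lin i, v - x i⟫) + G.ownQuad i (v - x i) := by
    funext v
    rw [← cost_update_add, add_sub_cancel]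
  rw [e, hasGradientAt_iff_hasFDerivAt]
  have h1 : HasFDerivAt (fun v => G.ownQuad i (v - x i)) (0 : Plane →L[ℝ] ℝ) (x i) :=
    (G.ownQuad_isBigO i (x i)).hasFDerivAt (by norm_num)
  have h2 : HasFDerivAt (fun v => ⟪G.hess i x + G.lin i, v - x i⟫)
      ((InnerProductSpace.toDual ℝ Plane) (G.hess i x + G.lin i)) (x i) :=
    ((InnerProductSpace.toDual ℝ Plane) (G.hess i x + G.lin i)).hasFDerivAt.comp (x i)
      ((hasFDerivAt_id (x i)).sub_const (x i))
  have h3 := (h2.const_add (G.cost i x)).add h1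
  rw [add_zero] at h3
  exact h3

theorem partialGrad_eq (i : Fin N) (x : Fin N → Plane) :
    G.partialGrad i x = G.hess i x + G.lin i :=
  (G.hasGradientAt_cost i x).gradient

/-- Fermat's rule gives one direction; nonnegativity of the second-order term `ownQuad` gives the
other. -/
theorem isNash_iff (x : Fin N → Plane) : G.IsNash x ↔ ∀ i, G.hess i x + G.lin i = 0 := by
  constructor
  · intro h i
    have hmin : IsLocalMin (fun v : Plane => G.cost i (Function.update x i v)) (x i) :=
      Filter.Eventually.of_forall fun v => by
        simpa using h i v
    have := hmin.hasFDerivAt_eq_zero (hasGradientAt_iff_hasFDerivAt.1 (G.hasGradientAt_cost i x))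
    exact (InnerProductSpace.toDual ℝ Plane).map_eq_zero_iff.1 this
  · intro h i v
    have := G.cost_update_add i x (v - x i)
    rw [add_sub_cancel, h i, inner_zero_left, add_zero] at this
    rw [this]
    linarith [G.ownQuad_nonneg i (v - x i)]

end SensorGame

/-! ### Coercivity by compactness, and positive weights for M-matrices -/

theorem exists_coercive_of_pos {E : Type*} [NormedAddCommGroup E] [NormedSpace ℝ E]
    [FiniteDimensional ℝ E] {q : E → ℝ} (hc : Continuous q)
    (hs : ∀ (r : ℝ) (z : E), q (r • z) = r ^ 2 * q z) (hp : ∀ z, z ≠ 0 → 0 < q z) :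
    ∃ m : ℝ, 0 < m ∧ ∀ z, m * ‖z‖ ^ 2 ≤ q z := by
  have q0 : q 0 = 0 := by simpa using hs 0 0
  rcases (Metric.sphere (0 : E) 1).eq_empty_or_nonempty with he | hne
  · refine ⟨1, one_pos, fun z => ?_⟩
    rcases eq_or_ne z 0 with rfl | hz
    · simp [q0]
    · exact absurd (show ‖z‖⁻¹ • z ∈ Metric.sphere (0 : E) 1 by
        simp [norm_smul, norm_ne_zero_iff.2 hz]) (by simp [he])
  · have : ProperSpace E := FiniteDimensional.proper ℝ E
    obtain ⟨u, hu, hmin⟩ := (isCompact_sphere (0 : E) 1).exists_isMinOn hne hc.continuousOn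
    refine ⟨q u, hp u (by rintro rfl; simp at hu), fun z => ?_⟩
    rcases eq_or_ne z 0 with rfl | hz
    · simp [q0]
    · have hz' := norm_ne_zero_iff.2 hz
      have h : q u ≤ q (‖z‖⁻¹ • z) := hmin (show ‖z‖⁻¹ • z ∈ Metric.sphere (0 : E) 1 by
        simp [norm_smul, hz'])
      rw [hs, inv_pow, ← div_eq_inv_mul, le_div_iff₀ (by positivity)] at h
      exact h

theorem Pi.sum_norm_sq_le {n : ℕ} {E : Type*} [SeminormedAddCommGroup E] (z : Fin n → E) :
    ∑ i, ‖z i‖ ^ 2 ≤ n * ‖z‖ ^ 2 := by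
  calc ∑ i, ‖z i‖ ^ 2 ≤ ∑ _i : Fin n, ‖z‖ ^ 2 := by
        gcongr with i
        exact norm_le_pi_norm z i
    _ = n * ‖z‖ ^ 2 := by simp

theorem Pi.norm_sq_le_sum {n : ℕ} {E : Type*} [SeminormedAddCommGroup E] (z : Fin n → E) :
    ‖z‖ ^ 2 ≤ ∑ i, ‖z i‖ ^ 2 := by
  have h : ‖z‖ ≤ √(∑ i, ‖z i‖ ^ 2) := by
    refine (pi_norm_le_iff_of_nonneg (Real.sqrt_nonneg _)).2 fun i => ?_
    exact Real.le_sqrt_of_sq_le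
      (Finset.single_le_sum (f := fun i => ‖z i‖ ^ 2) (fun _ _ => sq_nonneg _) (mem_univ i))
  calc ‖z‖ ^ 2 ≤ √(∑ i, ‖z i‖ ^ 2) ^ 2 := by gcongr
    _ = _ := Real.sq_sqrt (Finset.sum_nonneg fun _ _ => sq_nonneg _)

/-- The matrix `T = diag l + Laplacian of c` obeys a minimum principle: `T y ≥ 0` forces `y ≥ 0`.
Hence `T` is invertible with entrywise nonnegative inverse, and the column sums `w` of the inverse
satisfy `wᵀ T = (1, …, 1)`. -/
theorem exists_pos_weights {n : ℕ} {l : Fin n → ℝ} {c : Fin n → Fin n → ℝ}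
    (hl : ∀ i, 0 < l i) (hc : ∀ i j, 0 ≤ c i j) :
    ∃ w : Fin n → ℝ, (∀ i, 0 < w i) ∧
      ∀ y : Fin n → ℝ, ∑ i, w i * (l i * y i + ∑ j, c i j * (y i - y j)) = ∑ i, y i := by
  let T : (Fin n → ℝ) →ₗ[ℝ] (Fin n → ℝ) := LinearMap.pi fun i =>
    l i • (LinearMap.proj i : (Fin n → ℝ) →ₗ[ℝ] ℝ) +
      ∑ j, c i j • ((LinearMap.proj i : (Fin n → ℝ) →ₗ[ℝ] ℝ) - LinearMap.proj j)
  have hT (y i) : T y i = l i * y i + ∑ j, c i j * (y i - y j) := by simp [T]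
  have hmono (y : Fin n → ℝ) (hy : ∀ i, 0 ≤ T y i) (i : Fin n) : 0 ≤ y i := by
    -- At an index of the smallest entry the coupling sum is nonpositive, so a negative minimum
    -- would make `T y k` negative.
    obtain ⟨k, -, hk⟩ := Finset.exists_min_image univ y ⟨i, mem_univ i⟩
    refine le_trans ?_ (hk i (mem_univ i))
    by_contra! hneg
    have h1 : ∑ j, c k j * (y k - y j) ≤ 0 := Finset.sum_nonpos fun j hj =>
      mul_nonpos_of_nonneg_of_nonpos (hc k j) (sub_nonpos.2 (hk j hj))
    have h2 := hy k
    rw [hT] at h2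
    linarith [mul_neg_of_pos_of_neg (hl k) hneg]
  have hinj : Function.Injective T := by
    rw [← LinearMap.ker_eq_bot, LinearMap.ker_eq_bot']
    intro y hy
    funext i
    refine le_antisymm ?_ (hmono y (fun i => by simp [hy]) i)
    have := hmono (-y) (fun i => by simp [hy]) i
    simpa using this
  let e := LinearEquiv.ofInjectiveEndo T hinj
  have he (y) : T (e.symm y) = y := e.apply_symm_apply y
  let φ : (Fin n → ℝ) →ₗ[ℝ] ℝ := ∑ i, LinearMap.proj i
  have hφ (y) : φ y = ∑ i, y i := by simp [φ]
  refine ⟨fun i => φ (e.symm (Pi.single i 1)), fun i => ?_, fun y => ?_⟩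
  · beta_reduce
    have hnn : ∀ k, 0 ≤ e.symm (Pi.single i 1) k := hmono _ fun k => by
      rw [he]
      by_cases h : k = i
      · subst h; simp
      · simp [h]
    rw [hφ]
    -- A zero column sum would mean a zero column of the inverse.
    refine lt_of_le_of_ne (Finset.sum_nonneg fun k _ => hnn k) fun h0 => ?_
    have hz : e.symm (Pi.single i 1) = 0 := by
      funext k
      exact (Finset.sum_eq_zero_iff_of_nonneg fun k _ => hnn k).1 h0.symm k (mem_univ k)
    have := congrFun (he (Pi.single i 1)) i
    rw [hz] at this
    simp at this
  · have h := LinearMap.pi_apply_eq_sum_univ (φ ∘ₗ e.symm.toLinearMap) (T y)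
    have h' : e.symm (T y) = y := e.symm_apply_apply y
    simp only [LinearMap.comp_apply, LinearEquiv.coe_coe, h', hφ y] at h
    rw [h]
    refine Finset.sum_congr rfl fun i _ => ?_
    rw [← hT, smul_eq_mul, mul_comm]
    congr 1
    beta_reduce
    congr 2
    funext k
    simp [Pi.single_apply, eq_comm]

/-! ### Positivity of the pinned Laplacian -/

namespace CommGraph

variable {N : ℕ} (A : CommGraph N)

/-- The `i`-th block of the Laplacian of the graph, pinned at node `j`. -/
noncomputable def pinnedLap (j : Fin N) (z : Fin N → Plane) (i : Fin N) : Plane :=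
  ∑ k, A.a i k • (z i - z k) + A.a i j • z i

theorem sum_inner_pinnedLap (j : Fin N) (z : Fin N → Plane) :
    ∑ i, ⟪z i, A.pinnedLap j z i⟫ =
      (∑ i, ∑ k, A.a i k * ‖z i - z k‖ ^ 2) / 2 + ∑ i, A.a i j * ‖z i‖ ^ 2 := by
  have h1 : ∑ i, ∑ k, A.a i k * ⟪z i, z i - z k⟫ = ∑ i, ∑ k, A.a i k * ⟪z k, z k - z i⟫ := by
    rw [Finset.sum_comm]
    refine Finset.sum_congr rfl fun i _ => Finset.sum_congr rfl fun k _ => ?_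
    rw [A.symm k i]
  have h2 : ∑ i, ∑ k, A.a i k * ‖z i - z k‖ ^ 2 =
      ∑ i, ∑ k, A.a i k * ⟪z i, z i - z k⟫ + ∑ i, ∑ k, A.a i k * ⟪z k, z k - z i⟫ := by
    simp_rw [← Finset.sum_add_distrib]
    refine Finset.sum_congr rfl fun i _ => Finset.sum_congr rfl fun k _ => ?_
    rw [← real_inner_self_eq_norm_sq, inner_sub_left, ← neg_sub (z i) (z k), inner_neg_right]
    ring
  rw [h2, ← h1]
  simp only [pinnedLap, inner_add_right, inner_sum, real_inner_smul_right, Finset.sum_add_distrib,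
    real_inner_self_eq_norm_sq]
  ring

/-- If the form vanishes, `z` is constant along edges, hence constant by connectedness. As `a j j =
0`, the pinning acts only through neighbours of `j`; one exists because `2 ≤ N`, and there `z`
vanishes. -/
theorem sum_inner_pinnedLap_pos (hN : 2 ≤ N) (hA : A.toSimpleGraph.Connected) (j : Fin N)
    {z : Fin N → Plane} (hz : z ≠ 0) : 0 < ∑ i, ⟪z i, A.pinnedLap j z i⟫ := by
  rw [sum_inner_pinnedLap]
  have hnn : ∀ i, 0 ≤ ∑ k, A.a i k * ‖z i - z k‖ ^ 2 := fun i =>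
    Finset.sum_nonneg fun k _ => mul_nonneg (A.nonneg i k) (sq_nonneg _)
  have hnn' : ∀ i, 0 ≤ A.a i j * ‖z i‖ ^ 2 := fun i => mul_nonneg (A.nonneg i j) (sq_nonneg _)
  have hs := Finset.sum_nonneg fun i (_ : i ∈ univ) => hnn i
  have hs' := Finset.sum_nonneg fun i (_ : i ∈ univ) => hnn' i
  by_contra! hle
  apply hz
  have e1 : ∑ i, ∑ k, A.a i k * ‖z i - z k‖ ^ 2 = 0 := by linarith
  have e2 : ∑ i, A.a i j * ‖z i‖ ^ 2 = 0 := by linarith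
  have hadj : ∀ i k, A.toSimpleGraph.Adj i k → z i = z k := by
    intro i k hik
    have h1 := (Finset.sum_eq_zero_iff_of_nonneg fun i _ => hnn i).1 e1 i (mem_univ i)
    have h2 := (Finset.sum_eq_zero_iff_of_nonneg fun k _ =>
      mul_nonneg (A.nonneg i k) (sq_nonneg _)).1 h1 k (mem_univ k)
    have hpos : A.a i k ≠ 0 := ne_of_gt hik
    simpa [hpos, sub_eq_zero] using h2
  have hreach : ∀ i k, z i = z k := by
    intro i k
    obtain ⟨p⟩ := hA.preconnected i k
    induction p with
    | nil => rfl
    | cons h _ ih => exact (hadj _ _ h).trans ih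
  have : Nontrivial (Fin N) := Fin.nontrivial_iff_two_le.2 hN
  obtain ⟨m, hm⟩ := hA.preconnected.exists_adj_of_nontrivial j
  have hmj : A.a m j ≠ 0 := ne_of_gt hm.symm
  have h2 := (Finset.sum_eq_zero_iff_of_nonneg fun i _ => hnn' i).1 e2 m (mem_univ m)
  have hzm : z m = 0 := by simpa [hmj] using h2
  funext i
  rw [hreach i m, hzm]
  rfl

theorem exists_pinnedLap_coercive (hN : 2 ≤ N) (hA : A.toSimpleGraph.Connected) :
    ∃ m : ℝ, 0 < m ∧ ∀ (j : Fin N) (z : Fin N → Plane),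
      m * ∑ i, ‖z i‖ ^ 2 ≤ ∑ i, ⟪z i, A.pinnedLap j z i⟫ := by
  have hN' : (0 : ℝ) < N := by positivity
  have h (j : Fin N) : ∃ m : ℝ, 0 < m ∧ ∀ z : Fin N → Plane,
      m * ‖z‖ ^ 2 ≤ ∑ i, ⟪z i, A.pinnedLap j z i⟫ := by
    refine exists_coercive_of_pos ?_ ?_ fun z hz => A.sum_inner_pinnedLap_pos hN hA j hz
    · unfold pinnedLap
      fun_prop
    · intro r z
      rw [Finset.mul_sum]
      refine Finset.sum_congr rfl fun i _ => ?_
      have : A.pinnedLap j (r • z) i = r • A.pinnedLap j z i := by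
        simp only [pinnedLap, Pi.smul_apply, ← smul_sub, smul_add, Finset.smul_sum]
        simp only [smul_comm r]
      rw [this, Pi.smul_apply, real_inner_smul_left, real_inner_smul_right]
      ring
  choose m hm hm' using h
  have : Nonempty (Fin N) := ⟨⟨0, by omega⟩⟩
  obtain ⟨k, hk⟩ := Finite.exists_min m
  -- The least of the finitely many constants serves every `j`; dividing by `N` passes from the sup
  -- norm to the sum of squares.
  refine ⟨m k / N, by have := hm k; positivity, fun j z => ?_⟩
  calc m k / N * ∑ i, ‖z i‖ ^ 2 ≤ m k / N * (N * ‖z‖ ^ 2) := by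
        have := hm k
        gcongr
        exact Pi.sum_norm_sq_le z
    _ = m k * ‖z‖ ^ 2 := by field_simp
    _ ≤ m j * ‖z‖ ^ 2 := by gcongr; exact hk j
    _ ≤ _ := hm' j z

end CommGraph

/-! ### Weighted strong monotonicity and the unique equilibrium -/

namespace SensorGame

variable {N : ℕ} (G : SensorGame N)

/-- Since `2⟪z_i, z_i - z_j⟫ ≥ ‖z_i‖² - ‖z_j‖²`, the claim reduces to the scalar weights applied to
`y_i = ‖z_i‖²`. -/
theorem exists_weights : ∃ w : Fin N → ℝ, (∀ i, 0 < w i) ∧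
    ∀ z : Fin N → Plane, ∑ i, ‖z i‖ ^ 2 ≤ ∑ i, w i * ⟪z i, G.hess i z⟫ := by
  have h (i : Fin N) : ∃ m : ℝ, 0 < m ∧ ∀ v : Plane, m * ‖v‖ ^ 2 ≤ ⟪v, G.quadLin i v⟫ := by
    refine exists_coercive_of_pos ?_ ?_ fun v hv => G.inner_quadLin_pos i hv
    · exact continuous_id.inner (G.quadLin i).continuous_of_finiteDimensional
    · intro r v
      rw [map_smul, real_inner_smul_left, real_inner_smul_right]
      ring
  choose m hm hm' using h
  obtain ⟨w, hw, hsum⟩ := exists_pos_weights (l := fun i => 2 * m i) (c := G.coupling)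
    (fun i => by have := hm i; positivity) G.coupling_nonneg
  refine ⟨w, hw, fun z => ?_⟩
  rw [← hsum]
  gcongr with i
  · exact (hw i).le
  rw [hess_apply, inner_add_right, real_inner_smul_right, inner_sum]
  refine add_le_add (by linarith [hm' i (z i)]) ?_
  gcongr with j
  rw [real_inner_smul_right, inner_sub_right, real_inner_self_eq_norm_sq]
  have h := mul_nonneg (G.coupling_nonneg i j) (sq_nonneg ‖z i - z j‖)
  rw [norm_sub_sq_real] at h
  linarith

theorem existsUnique_isNash : ∃! xs : Fin N → Plane, G.IsNash xs := by
  obtain ⟨w, hw, hsum⟩ := G.exists_weights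
  let T : (Fin N → Plane) →ₗ[ℝ] (Fin N → Plane) := LinearMap.pi G.hess
  have hinj : Function.Injective T := by
    rw [← LinearMap.ker_eq_bot, LinearMap.ker_eq_bot']
    intro z hz
    have h1 := hsum z
    have h2 : ∀ i, G.hess i z = 0 := fun i => congrFun hz i
    simp only [h2, inner_zero_right, mul_zero, Finset.sum_const_zero] at h1
    have h3 := Finset.sum_nonneg fun i (_ : i ∈ univ) => sq_nonneg ‖z i‖
    funext i
    simpa using (Finset.sum_eq_zero_iff_of_nonneg fun i _ => sq_nonneg ‖z i‖).1
      (le_antisymm h1 h3) i (mem_univ i)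
  have hsurj : Function.Surjective T := LinearMap.injective_iff_surjective.1 hinj
  obtain ⟨xs, hxs⟩ := hsurj fun i => -G.lin i
  refine ⟨xs, (G.isNash_iff xs).2 fun i => ?_, fun y hy => hinj ?_⟩
  · rw [show G.hess i xs = -G.lin i from congrFun hxs i, neg_add_cancel]
  · rw [hxs]
    funext i
    exact eq_neg_of_add_eq_zero_left ((G.isNash_iff y).1 hy i)

theorem exists_hess_bound : ∃ C : ℝ, 0 < C ∧ ∀ (i : Fin N) (z : Fin N → Plane),
    ‖G.hess i z‖ ^ 2 ≤ C * ∑ j, ‖z j‖ ^ 2 := by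
  let L (i : Fin N) := LinearMap.toContinuousLinearMap (G.hess i)
  obtain ⟨M, hM⟩ := Finite.exists_le fun i => ‖L i‖ ^ 2
  refine ⟨max M 1, by positivity, fun i z => ?_⟩
  calc ‖G.hess i z‖ ^ 2 ≤ (‖L i‖ * ‖z‖) ^ 2 := by
        gcongr
        exact (L i).le_opNorm z
    _ = ‖L i‖ ^ 2 * ‖z‖ ^ 2 := mul_pow _ _ _
    _ ≤ _ := by
        gcongr
        · exact (hM i).trans (le_max_left _ _)
        · exact Pi.norm_sq_le_sum z

end SensorGame

/-! ### Comparison lemma and Young's inequality -/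

theorem exists_forall_gt_le_of_hasDerivWithinAt_le {U U' : ℝ → ℝ} {t₀ α ε b : ℝ} (hα : 0 < α)
    (hU : ∀ t, t₀ ≤ t → HasDerivWithinAt U (U' t) (Set.Ici t₀) t)
    (hle : ∀ t, t₀ ≤ t → U' t ≤ -α * U t + ε) (hb : ε / α < b) :
    ∃ T, t₀ ≤ T ∧ ∀ t, T < t → U t ≤ b := by
  -- Integrating factor: the excess of `U` over the rest level `ε / α` decays at least like `exp (-α
  -- t)`.
  have hanti : AntitoneOn (fun t => Real.exp (α * t) * (U t - ε / α)) (Set.Ici t₀) := by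
    have hder : ∀ t, t₀ ≤ t → HasDerivWithinAt (fun t => Real.exp (α * t) * (U t - ε / α))
        (Real.exp (α * t) * α * (U t - ε / α) + Real.exp (α * t) * U' t) (Set.Ici t₀) t := by
      intro t ht
      have h1 : HasDerivAt (fun t => Real.exp (α * t)) (Real.exp (α * t) * α) t := by
        simpa using ((hasDerivAt_id t).const_mul α).exp
      exact h1.hasDerivWithinAt.mul ((hU t ht).sub_const (ε / α))
    refine antitoneOn_of_hasDerivWithinAt_nonpos (convex_Ici t₀)
      (f' := fun t => Real.exp (α * t) * α * (U t - ε / α) + Real.exp (α * t) * U' t)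
      (fun t ht => (hder t ht).continuousWithinAt)
      (fun t ht => (hder t (interior_subset ht)).mono interior_subset) fun t ht => ?_
    have h1 : Real.exp (α * t) * α * (U t - ε / α) + Real.exp (α * t) * U' t =
        Real.exp (α * t) * (U' t + α * U t - ε) := by
      field_simp
      ring
    rw [h1]
    exact mul_nonpos_of_nonneg_of_nonpos (Real.exp_pos _).le
      (by linarith [hle t (interior_subset ht)])
  have hlim : Filter.Tendsto
      (fun t => Real.exp (-(α * t)) * (Real.exp (α * t₀) * (U t₀ - ε / α)) + ε / α)
      Filter.atTop (nhds (0 * (Real.exp (α * t₀) * (U t₀ - ε / α)) + ε / α)) := by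
    refine ((Real.tendsto_exp_neg_atTop_nhds_zero.comp
      (Filter.tendsto_id.const_mul_atTop hα)).mul_const _).add_const _
  rw [zero_mul, zero_add] at hlim
  obtain ⟨T, hT⟩ := Filter.eventually_atTop.1 (hlim.eventually (gt_mem_nhds hb))
  refine ⟨max T t₀, le_max_right _ _, fun t ht => ?_⟩
  have htt : t₀ ≤ t := (le_max_right _ _).trans ht.le
  have h1 := hanti (Set.self_mem_Ici) htt htt
  have h2 := hT t ((le_max_left _ _).trans ht.le)
  have h3 := mul_le_mul_of_nonneg_left h1 (Real.exp_pos (-(α * t))).le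
  beta_reduce at h3
  rw [← mul_assoc, ← Real.exp_add, neg_add_cancel, Real.exp_zero, one_mul] at h3
  linarith

theorem two_mul_inner_le {E : Type*} [NormedAddCommGroup E] [InnerProductSpace ℝ E] (u v : E)
    {s : ℝ} (hs : 0 < s) : 2 * ⟪u, v⟫ ≤ s * ‖u‖ ^ 2 + ‖v‖ ^ 2 / s := by
  have h := real_inner_le_norm u v
  have h2 : s * ‖u‖ ^ 2 + ‖v‖ ^ 2 / s - 2 * (‖u‖ * ‖v‖) = (s * ‖u‖ - ‖v‖) ^ 2 / s := by
    field_simp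
    ring
  have h3 : 0 ≤ (s * ‖u‖ - ‖v‖) ^ 2 / s := by positivity
  linarith

/-! ### Lyapunov function of the scaled observer error -/

namespace FixedGains

variable {N : ℕ} (K : FixedGains N)

/-- The first diagonal weight of the Lyapunov function of the scaled observer error. -/
noncomputable def obsA (i : Fin N) : ℝ := (K.k₂ i + 1) / K.k₁ i

/-- The second diagonal weight of the Lyapunov function of the scaled observer error. -/
noncomputable def obsC (i : Fin N) : ℝ := (K.obsA i + K.k₁ i) / K.k₂ i

theorem obsA_pos (i : Fin N) : 0 < K.obsA i :=
  div_pos (by linarith [K.k₂_pos i]) (K.k₁_pos i)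

theorem obsC_pos (i : Fin N) : 0 < K.obsC i :=
  div_pos (by linarith [K.k₁_pos i, K.obsA_pos i]) (K.k₂_pos i)

/-- This and the next identity solve the Lyapunov equation for the system `p' = q - k₁ p`, `q' = -k₂
p`: with off-diagonal entry `-1`, the derivative of the form is exactly `-2(‖p‖² + ‖q‖²)`. -/
theorem obsA_mul_k₁ (i : Fin N) : K.obsA i * K.k₁ i = K.k₂ i + 1 :=
  div_mul_cancel₀ _ (K.k₁_pos i).ne'

theorem obsC_mul_k₂ (i : Fin N) : K.obsC i * K.k₂ i = K.obsA i + K.k₁ i :=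
  div_mul_cancel₀ _ (K.k₂_pos i).ne'

/-- Positivity of the determinant of the form. -/
theorem one_lt_obsA_mul_obsC (i : Fin N) : 1 < K.obsA i * K.obsC i := by
  have h1 := K.obsA_mul_k₁ i
  have h2 := K.obsC_mul_k₂ i
  have h3 : K.obsA i * K.obsC i * K.k₂ i = K.obsA i ^ 2 + K.k₂ i + 1 := by
    rw [mul_assoc, h2, mul_add, h1]
    ring
  have h4 : 1 * K.k₂ i < K.obsA i * K.obsC i * K.k₂ i := by
    rw [h3]
    nlinarith [sq_nonneg (K.obsA i)]
  exact lt_of_mul_lt_mul_right h4 (K.k₂_pos i).le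

/-- The Lyapunov function of the scaled observer error of sensor `i`. -/
noncomputable def obsLyap (i : Fin N) (p q : Plane) : ℝ :=
  K.obsA i * ‖p‖ ^ 2 - 2 * ⟪p, q⟫ + K.obsC i * ‖q‖ ^ 2

/-- The derivative of `obsLyap` along a curve with velocities `p'` and `q'`. -/
noncomputable def obsLyapDeriv (i : Fin N) (p q p' q' : Plane) : ℝ :=
  K.obsA i * (2 * ⟪p, p'⟫) - 2 * (⟪p, q'⟫ + ⟪p', q⟫) + K.obsC i * (2 * ⟪q, q'⟫)

theorem obsLyap_le (i : Fin N) (p q : Plane) :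
    K.obsLyap i p q ≤ (K.obsA i + K.obsC i + 1) * (‖p‖ ^ 2 + ‖q‖ ^ 2) := by
  have h := two_mul_inner_le (-p) q one_pos
  rw [inner_neg_left, norm_neg] at h
  unfold obsLyap
  nlinarith [mul_nonneg (K.obsA_pos i).le (sq_nonneg ‖q‖),
    mul_nonneg (K.obsC_pos i).le (sq_nonneg ‖p‖)]

theorem exists_le_obsLyap (i : Fin N) :
    ∃ m : ℝ, 0 < m ∧ ∀ p q : Plane, m * (‖p‖ ^ 2 + ‖q‖ ^ 2) ≤ K.obsLyap i p q := by
  have ha := K.obsA_pos i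
  have hc := K.obsC_pos i
  have hac := K.one_lt_obsA_mul_obsC i
  set a := K.obsA i
  set c := K.obsC i
  -- Determinant over trace bounds the smaller eigenvalue from below: `(a - m)(c - m) = 1 + m²` for
  -- this `m`.
  have hm : 0 < (a * c - 1) / (a + c) := div_pos (by linarith) (by linarith)
  have hmul : (a * c - 1) / (a + c) * (a + c) = a * c - 1 := div_mul_cancel₀ _ (by positivity)
  set m := (a * c - 1) / (a + c)
  have ham : 0 < a - m := by
    refine sub_pos.2 ((div_lt_iff₀ (by positivity)).2 ?_)
    nlinarith
  refine ⟨m, hm, fun p q => ?_⟩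
  have h := two_mul_inner_le p q ham
  have h2 : ‖q‖ ^ 2 / (a - m) ≤ (c - m) * ‖q‖ ^ 2 := by
    rw [div_le_iff₀ ham]
    have : 1 ≤ (c - m) * (a - m) := by nlinarith [sq_nonneg m]
    nlinarith [mul_le_mul_of_nonneg_right this (sq_nonneg ‖q‖)]
  unfold obsLyap
  linarith

theorem obsLyapDeriv_le (i : Fin N) (p q e : Plane) {σ : ℝ} (hσ : 0 < σ) :
    K.obsLyapDeriv i p q (σ • (q - K.k₁ i • p)) (e - (σ * K.k₂ i) • p) ≤
      -σ * (‖p‖ ^ 2 + ‖q‖ ^ 2) + (1 + K.obsC i ^ 2) * ‖e‖ ^ 2 / σ := by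
  have h1 := K.obsA_mul_k₁ i
  have h2 := K.obsC_mul_k₂ i
  -- Young with parameter `σ` spends half of the decay `2σ` and leaves the forcing divided by `σ`.
  have h3 := two_mul_inner_le (-p) e hσ
  have h4 := two_mul_inner_le q (K.obsC i • e) hσ
  rw [inner_neg_left, norm_neg] at h3
  rw [real_inner_smul_right, norm_smul, mul_pow, Real.norm_eq_abs, sq_abs] at h4
  have h5 : K.obsLyapDeriv i p q (σ • (q - K.k₁ i • p)) (e - (σ * K.k₂ i) • p) =
      -2 * σ * (‖p‖ ^ 2 + ‖q‖ ^ 2) + (2 * -⟪p, e⟫ + 2 * (K.obsC i * ⟪q, e⟫)) := by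
    simp only [obsLyapDeriv, inner_sub_left, inner_sub_right, real_inner_smul_left,
      real_inner_smul_right, real_inner_self_eq_norm_sq, real_inner_comm p q]
    linear_combination (-2 * σ * ‖p‖ ^ 2) * h1 - 2 * σ * ⟪p, q⟫ * h2
  have h6 : (1 + K.obsC i ^ 2) * ‖e‖ ^ 2 / σ = ‖e‖ ^ 2 / σ + K.obsC i ^ 2 * ‖e‖ ^ 2 / σ := by
    ring
  rw [h5, h6]
  linarith

end FixedGains

/-! ### Cross terms between position and estimation errors -/

namespace SensorGame

variable {N : ℕ} (G : SensorGame N)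

/-- The velocity of sensor `i` in terms of the position, estimation and observer errors. -/
noncomputable def errorVel (ξ : Fin N → Plane) (η : Fin N → Fin N → Plane) (q : Fin N → Plane)
    (i : Fin N) : Plane :=
  -G.hess i ξ - G.hess i (η i) + q i

theorem exists_sum_inner_errorVel_le {w : Fin N → ℝ} (hw : ∀ i, 0 < w i)
    (hwle : ∀ z : Fin N → Plane, ∑ i, ‖z i‖ ^ 2 ≤ ∑ i, w i * ⟪z i, G.hess i z⟫) :
    ∃ B : ℝ, 0 < B ∧ ∀ (ξ : Fin N → Plane) (η : Fin N → Fin N → Plane) (q : Fin N → Plane),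
      ∑ i, w i * (2 * ⟪ξ i, G.errorVel ξ η q i⟫) ≤
        -(3 / 2) * ∑ i, ‖ξ i‖ ^ 2 + B * (∑ i, ∑ j, ‖η i j‖ ^ 2 + ∑ i, ‖q i‖ ^ 2) := by
  obtain ⟨C, hC, hCle⟩ := G.exists_hess_bound
  obtain ⟨W, hW⟩ := Finite.exists_le w
  set V := max W 1
  have hV : 0 < V := by positivity
  have hwV : ∀ i, w i ≤ V := fun i => (hW i).trans (le_max_left _ _)
  refine ⟨4 * V ^ 2 * (C + 1), by positivity, fun ξ η q => ?_⟩
  have hterm (i : Fin N) : w i * (2 * ⟪ξ i, G.errorVel ξ η q i⟫) ≤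
      -2 * (w i * ⟪ξ i, G.hess i ξ⟫) + (1 / 2 * ‖ξ i‖ ^ 2 +
        4 * V ^ 2 * (C + 1) * (∑ j, ‖η i j‖ ^ 2 + ‖q i‖ ^ 2)) := by
    -- Parameter `1 / 2` uses up a quarter of the decay `-2‖ξ‖²`, leaving `3 / 2`.
    have h1 := two_mul_inner_le (ξ i) (w i • (q i - G.hess i (η i))) (s := 1 / 2) (by norm_num)
    have h2 : ‖w i • (q i - G.hess i (η i))‖ ^ 2 ≤ V ^ 2 * (2 * (‖q i‖ ^ 2 +
        C * ∑ j, ‖η i j‖ ^ 2)) := by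
      rw [norm_smul, mul_pow, Real.norm_eq_abs, abs_of_pos (hw i)]
      gcongr
      · exact (hw i).le
      · exact hwV i
      · have h3 := parallelogram_law_with_norm ℝ (q i) (G.hess i (η i))
        nlinarith [hCle i (η i), mul_self_nonneg ‖q i + G.hess i (η i)‖]
    have h4 : w i * (2 * ⟪ξ i, G.errorVel ξ η q i⟫) = -2 * (w i * ⟪ξ i, G.hess i ξ⟫) +
        2 * ⟪ξ i, w i • (q i - G.hess i (η i))⟫ := by
      simp only [errorVel, inner_add_right, inner_sub_right, inner_neg_right,
        real_inner_smul_right]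
      ring
    have h5 : 0 ≤ ∑ j, ‖η i j‖ ^ 2 := Finset.sum_nonneg fun _ _ => sq_nonneg _
    have h6 : 0 ≤ V ^ 2 * (∑ j, ‖η i j‖ ^ 2 + C * ‖q i‖ ^ 2) := by positivity
    rw [h4]
    linarith
  refine (Finset.sum_le_sum fun i _ => hterm i).trans ?_
  simp only [Finset.sum_add_distrib, ← Finset.mul_sum]
  linarith [hwle ξ]

theorem exists_sum_errorVel_sq_le : ∃ C : ℝ, 0 < C ∧
    ∀ (ξ : Fin N → Plane) (η : Fin N → Fin N → Plane) (q : Fin N → Plane),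
      ∑ i, ‖G.errorVel ξ η q i‖ ^ 2 ≤
        C * (∑ i, ‖ξ i‖ ^ 2 + ∑ i, ∑ j, ‖η i j‖ ^ 2 + ∑ i, ‖q i‖ ^ 2) := by
  obtain ⟨C, hC, hCle⟩ := G.exists_hess_bound
  refine ⟨4 * (N * C + C + 1), by positivity, fun ξ η q => ?_⟩
  have hterm (i : Fin N) : ‖G.errorVel ξ η q i‖ ^ 2 ≤
      4 * C * ∑ j, ‖ξ j‖ ^ 2 + 4 * C * ∑ j, ‖η i j‖ ^ 2 + 4 * ‖q i‖ ^ 2 := by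
    have h1 : ‖G.errorVel ξ η q i‖ ≤ ‖G.hess i ξ‖ + ‖G.hess i (η i)‖ + ‖q i‖ := by
      refine (norm_add_le _ _).trans (add_le_add_left ((norm_sub_le _ _).trans ?_) _)
      rw [norm_neg]
    have h2 : ‖G.errorVel ξ η q i‖ ^ 2 ≤
        (‖G.hess i ξ‖ + ‖G.hess i (η i)‖ + ‖q i‖) ^ 2 := by gcongr
    have h3 := hCle i ξ
    have h4 := hCle i (η i)
    nlinarith [sq_nonneg (‖G.hess i ξ‖ - ‖G.hess i (η i)‖), sq_nonneg (‖G.hess i ξ‖ - ‖q i‖),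
      sq_nonneg (‖G.hess i (η i)‖ - ‖q i‖), sq_nonneg ‖q i‖, sq_nonneg ‖G.hess i ξ‖,
      sq_nonneg ‖G.hess i (η i)‖]
  refine (Finset.sum_le_sum fun i _ => hterm i).trans ?_
  simp only [Finset.sum_add_distrib, ← Finset.mul_sum, Finset.sum_const, Finset.card_univ,
    Fintype.card_fin, nsmul_eq_mul]
  have hX : 0 ≤ ∑ i, ‖ξ i‖ ^ 2 := Finset.sum_nonneg fun _ _ => sq_nonneg _
  have hH : 0 ≤ ∑ i, ∑ j, ‖η i j‖ ^ 2 :=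
    Finset.sum_nonneg fun _ _ => Finset.sum_nonneg fun _ _ => sq_nonneg _
  have hZ : 0 ≤ ∑ i, ‖q i‖ ^ 2 := Finset.sum_nonneg fun _ _ => sq_nonneg _
  have hNC : 0 ≤ (N : ℝ) * C := by positivity
  nlinarith [mul_nonneg hNC hH, mul_nonneg hNC hZ, mul_nonneg hC.le hX, mul_nonneg hC.le hZ]

theorem exists_sum_inner_estimation_le (hN : 2 ≤ N) (A : CommGraph N)
    (hA : A.toSimpleGraph.Connected) (K : FixedGains N) :
    ∃ m B : ℝ, 0 < m ∧ 0 < B ∧ ∀ θ : ℝ, 0 < θ →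
      ∀ (ξ : Fin N → Plane) (η : Fin N → Fin N → Plane) (q : Fin N → Plane),
      ∑ i, ∑ j, (K.thetaBar i j)⁻¹ * (2 * ⟪η i j,
          -((θ * K.thetaBar i j) • A.pinnedLap j (fun k => η k j) i) - G.errorVel ξ η q j⟫) ≤
        1 / 2 * ∑ i, ‖ξ i‖ ^ 2 - θ * m * ∑ i, ∑ j, ‖η i j‖ ^ 2 +
          B * (∑ i, ∑ j, ‖η i j‖ ^ 2 + ∑ i, ‖q i‖ ^ 2) := by
  obtain ⟨m, hm, hmle⟩ := A.exists_pinnedLap_coercive hN hA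
  obtain ⟨C, hC, hCle⟩ := G.exists_sum_errorVel_sq_le
  obtain ⟨b, hb⟩ := Finite.exists_le fun p : Fin N × Fin N => (K.thetaBar p.1 p.2)⁻¹ ^ 2
  have hN' : (0 : ℝ) < N := by positivity
  -- Each velocity `v j` enters the errors of all `N` estimators, so this `s` makes the cost in
  -- `‖ξ‖²` exactly `s⁻¹ N C = 1 / 2`, less than the available `3 / 2`.
  set s : ℝ := 2 * N * C with hs
  have hspos : 0 < s := by positivity
  refine ⟨2 * m, s * max b 1 + 1, by positivity, by positivity, fun θ hθ ξ η q => ?_⟩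
  set v := G.errorVel ξ η q
  have hterm (i j : Fin N) : (K.thetaBar i j)⁻¹ * (2 * ⟪η i j,
      -((θ * K.thetaBar i j) • A.pinnedLap j (fun k => η k j) i) - v j⟫) ≤
      -(2 * θ) * ⟪η i j, A.pinnedLap j (fun k => η k j) i⟫ +
        (s * max b 1 * ‖η i j‖ ^ 2 + s⁻¹ * ‖v j‖ ^ 2) := by
    have hpos := K.thetaBar_pos i j
    have h1 := two_mul_inner_le (-(K.thetaBar i j)⁻¹ • η i j) (v j) hspos
    rw [norm_smul, real_inner_smul_left, mul_pow, norm_neg, Real.norm_eq_abs, sq_abs] at h1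
    have h2 : (K.thetaBar i j)⁻¹ ^ 2 ≤ max b 1 := (hb (i, j)).trans (le_max_left _ _)
    have h3 : s * ((K.thetaBar i j)⁻¹ ^ 2 * ‖η i j‖ ^ 2) ≤ s * (max b 1 * ‖η i j‖ ^ 2) := by
      gcongr
    -- The weight `thetaBar⁻¹` cancels the individual gains, which restores the symmetric Laplacian
    -- form.
    have h4 : (K.thetaBar i j)⁻¹ * (2 * ⟪η i j,
        -((θ * K.thetaBar i j) • A.pinnedLap j (fun k => η k j) i) - v j⟫) =
        -(2 * θ) * ⟪η i j, A.pinnedLap j (fun k => η k j) i⟫ +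
          2 * (-(K.thetaBar i j)⁻¹ * ⟪η i j, v j⟫) := by
      rw [inner_sub_right, inner_neg_right, real_inner_smul_right]
      field_simp
      ring
    rw [h4]
    rw [div_eq_inv_mul] at h1
    linarith
  refine (Finset.sum_le_sum fun i _ => Finset.sum_le_sum fun j _ => hterm i j).trans ?_
  -- The estimates of different targets `j` decouple, so coercivity is applied target by target.
  have hL : m * ∑ i, ∑ j, ‖η i j‖ ^ 2 ≤
      ∑ i, ∑ j, ⟪η i j, A.pinnedLap j (fun k => η k j) i⟫ := by
    rw [Finset.sum_comm, Finset.mul_sum, Finset.sum_comm (γ := Fin N) (f := fun i j =>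
      ⟪η i j, A.pinnedLap j (fun k => η k j) i⟫)]
    exact Finset.sum_le_sum fun j _ => hmle j fun k => η k j
  simp only [Finset.sum_add_distrib, ← Finset.mul_sum, Finset.sum_const, Finset.card_univ,
    Fintype.card_fin, nsmul_eq_mul]
  have hv := hCle ξ η q
  have hv' := mul_le_mul_of_nonneg_left hv (show 0 ≤ s⁻¹ * N by positivity)
  have hsN : s⁻¹ * N * C = 1 / 2 := by
    rw [hs]
    field_simp
  rw [← mul_assoc, hsN] at hv'
  have hLθ := mul_le_mul_of_nonneg_left hL hθ.le
  have hH : 0 ≤ ∑ i, ∑ j, ‖η i j‖ ^ 2 :=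
    Finset.sum_nonneg fun _ _ => Finset.sum_nonneg fun _ _ => sq_nonneg _
  have hZ : 0 ≤ ∑ i, ‖q i‖ ^ 2 := Finset.sum_nonneg fun _ _ => sq_nonneg _
  have hsZ : 0 ≤ s * max b 1 * ∑ i, ‖q i‖ ^ 2 := by positivity
  linarith

end SensorGame

/-! ### Lyapunov analysis of the closed loop -/

section ClosedLoop

variable {N : ℕ} (G : SensorGame N) (A : CommGraph N) (K : FixedGains N)

/-- The Lyapunov function of the closed loop, in terms of the position error `ξ`, the estimation
error `η`, and the scaled observer errors `p` and `q`. -/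
noncomputable def loopLyap (w : Fin N → ℝ) (ξ : Fin N → Plane) (η : Fin N → Fin N → Plane)
    (p q : Fin N → Plane) : ℝ :=
  ∑ i, w i * ‖ξ i‖ ^ 2 + ∑ i, ∑ j, (K.thetaBar i j)⁻¹ * ‖η i j‖ ^ 2 +
    ∑ i, K.obsLyap i (p i) (q i)

/-- The squared norm of the scaled error. -/
noncomputable def errSq (ξ : Fin N → Plane) (η : Fin N → Fin N → Plane)
    (p q : Fin N → Plane) : ℝ :=
  ∑ i, ‖ξ i‖ ^ 2 + ∑ i, ∑ j, ‖η i j‖ ^ 2 + ∑ i, (‖p i‖ ^ 2 + ‖q i‖ ^ 2)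

theorem exists_loopLyap_le (w : Fin N → ℝ) : ∃ B : ℝ, 0 < B ∧ ∀ ξ η p q,
    loopLyap K w ξ η p q ≤ B * errSq ξ η p q := by
  obtain ⟨B₁, h₁⟩ := Finite.exists_le w
  obtain ⟨B₂, h₂⟩ := Finite.exists_le fun p : Fin N × Fin N => (K.thetaBar p.1 p.2)⁻¹
  obtain ⟨B₃, h₃⟩ := Finite.exists_le fun i => K.obsA i + K.obsC i + 1
  set B := max 1 (max B₁ (max B₂ B₃))
  have hB₁ : B₁ ≤ B := by simp [B]
  have hB₂ : B₂ ≤ B := by simp [B]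
  have hB₃ : B₃ ≤ B := by simp [B]
  refine ⟨B, by positivity, fun ξ η p q => ?_⟩
  unfold loopLyap errSq
  simp only [mul_add, Finset.mul_sum]
  simp only [← mul_add]
  gcongr with i _ i _ j _ i _
  · exact (h₁ i).trans hB₁
  · exact (h₂ (i, j)).trans hB₂
  · refine (K.obsLyap_le i (p i) (q i)).trans ?_
    gcongr
    exact (h₃ i).trans hB₃

theorem exists_le_loopLyap {w : Fin N → ℝ} (hw : ∀ i, 0 < w i) (hN : 2 ≤ N) :
    ∃ m : ℝ, 0 < m ∧ ∀ ξ η p q, m * errSq ξ η p q ≤ loopLyap K w ξ η p q := by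
  have : Nonempty (Fin N) := ⟨⟨0, by omega⟩⟩
  choose r hr hrle using K.exists_le_obsLyap
  obtain ⟨i₁, h₁⟩ := Finite.exists_min w
  obtain ⟨i₂, h₂⟩ := Finite.exists_min fun p : Fin N × Fin N => (K.thetaBar p.1 p.2)⁻¹
  obtain ⟨i₃, h₃⟩ := Finite.exists_min r
  set m := min (w i₁) (min (K.thetaBar i₂.1 i₂.2)⁻¹ (r i₃))
  have hm : 0 < m := lt_min (hw _) (lt_min (inv_pos.2 (K.thetaBar_pos _ _)) (hr _))
  have hm₁ : m ≤ w i₁ := by simp [m]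
  have hm₂ : m ≤ (K.thetaBar i₂.1 i₂.2)⁻¹ := by simp [m]
  have hm₃ : m ≤ r i₃ := by simp [m]
  refine ⟨m, hm, fun ξ η p q => ?_⟩
  unfold loopLyap errSq
  simp only [mul_add, Finset.mul_sum]
  simp only [← mul_add]
  gcongr with i _ i _ j _ i _
  · exact hm₁.trans (h₁ i)
  · exact hm₂.trans (h₂ (i, j))
  · refine le_trans ?_ (hrle i (p i) (q i))
    gcongr
    exact hm₃.trans (h₃ i)

/-- The derivative of `loopLyap` along the error dynamics, in which `e` are the derivatives of
the disturbances. -/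
noncomputable def loopLyapDeriv (w : Fin N → ℝ) (θ σ : ℝ) (ξ : Fin N → Plane)
    (η : Fin N → Fin N → Plane) (p q e : Fin N → Plane) : ℝ :=
  ∑ i, w i * (2 * ⟪ξ i, G.errorVel ξ η q i⟫) +
    ∑ i, ∑ j, (K.thetaBar i j)⁻¹ * (2 * ⟪η i j,
      -((θ * K.thetaBar i j) • A.pinnedLap j (fun k => η k j) i) - G.errorVel ξ η q j⟫) +
    ∑ i, K.obsLyapDeriv i (p i) (q i) (σ • (q i - K.k₁ i • p i)) (e i - (σ * K.k₂ i) • p i)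

theorem exists_loopLyapDeriv_le (hN : 2 ≤ N) (hA : A.toSimpleGraph.Connected) {w : Fin N → ℝ}
    (hw : ∀ i, 0 < w i)
    (hwle : ∀ z : Fin N → Plane, ∑ i, ‖z i‖ ^ 2 ≤ ∑ i, w i * ⟪z i, G.hess i z⟫) (M : Fin N → ℝ) :
    ∃ θs σs D : ℝ, 0 < θs ∧ 0 < σs ∧ 0 < D ∧ ∀ θ, θs < θ → ∀ σ, σs < σ →
      ∀ ξ η p q e, (∀ i, ‖e i‖ ≤ M i) →
        loopLyapDeriv G A K w θ σ ξ η p q e ≤ -errSq ξ η p q + D / σ := by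
  obtain ⟨B₁, hB₁, h₁⟩ := G.exists_sum_inner_errorVel_le hw hwle
  obtain ⟨m, B₂, hm, hB₂, h₂⟩ := G.exists_sum_inner_estimation_le hN A hA K
  have hD : 0 ≤ ∑ i, (1 + K.obsC i ^ 2) * M i ^ 2 :=
    Finset.sum_nonneg fun i _ => mul_nonneg (by positivity) (sq_nonneg _)
  -- The thresholds absorb the cross terms `B₁ + B₂` and leave coefficient `-1` on `η`, `p` and `q`;
  -- for `ξ` the balance is `-3/2 + 1/2`. The leading `1` in `D` only ensures positivity.
  refine ⟨(B₁ + B₂ + 1) / m, B₁ + B₂ + 1, 1 + ∑ i, (1 + K.obsC i ^ 2) * M i ^ 2, by positivity,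
    by positivity, by positivity, fun θ hθ σ hσ ξ η p q e he => ?_⟩
  have hθ₀ : 0 < θ := lt_trans (by positivity) hθ
  have hσ₀ : 0 < σ := lt_trans (by positivity) hσ
  have h₃ : ∑ i, K.obsLyapDeriv i (p i) (q i) (σ • (q i - K.k₁ i • p i))
      (e i - (σ * K.k₂ i) • p i) ≤
      -σ * ∑ i, (‖p i‖ ^ 2 + ‖q i‖ ^ 2) + (∑ i, (1 + K.obsC i ^ 2) * M i ^ 2) / σ := by
    rw [Finset.mul_sum, Finset.sum_div, ← Finset.sum_add_distrib]
    refine Finset.sum_le_sum fun i _ => (K.obsLyapDeriv_le i (p i) (q i) (e i) hσ₀).trans ?_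
    gcongr
    exact he i
  have h₄ := h₁ ξ η q
  have h₅ := h₂ θ hθ₀ ξ η q
  have hX : 0 ≤ ∑ i, ‖ξ i‖ ^ 2 := Finset.sum_nonneg fun _ _ => sq_nonneg _
  have hH : 0 ≤ ∑ i, ∑ j, ‖η i j‖ ^ 2 :=
    Finset.sum_nonneg fun _ _ => Finset.sum_nonneg fun _ _ => sq_nonneg _
  have hP : 0 ≤ ∑ i, ‖p i‖ ^ 2 := Finset.sum_nonneg fun _ _ => sq_nonneg _
  have hZ : 0 ≤ ∑ i, ‖q i‖ ^ 2 := Finset.sum_nonneg fun _ _ => sq_nonneg _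
  have h₆ : (B₁ + B₂ + 1) * ∑ i, ∑ j, ‖η i j‖ ^ 2 ≤ θ * m * ∑ i, ∑ j, ‖η i j‖ ^ 2 :=
    mul_le_mul_of_nonneg_right ((div_lt_iff₀ hm).1 hθ).le hH
  have h₇ : (B₁ + B₂ + 1) * ∑ i, (‖p i‖ ^ 2 + ‖q i‖ ^ 2) ≤
      σ * ∑ i, (‖p i‖ ^ 2 + ‖q i‖ ^ 2) :=
    mul_le_mul_of_nonneg_right hσ.le (Finset.sum_nonneg fun _ _ => by positivity)
  have h₈ : 0 < 1 / σ := by positivity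
  have h₉ : 0 ≤ (B₁ + B₂) * ∑ i, ‖p i‖ ^ 2 := by positivity
  rw [Finset.sum_add_distrib] at h₃ h₇
  unfold loopLyapDeriv errSq
  rw [add_div, Finset.sum_add_distrib]
  linarith

variable {G A K} {d : Fin N → ℝ → Plane} {t₀ θ σ : ℝ} {S : ℝ → LoopState N}
  {xs : Fin N → Plane}

theorem IsTrajectory.hasDerivWithinAt_loopLyap (hS : IsTrajectory G A K d t₀ θ σ S)
    (hxs : G.IsNash xs) (w : Fin N → ℝ) {t : ℝ} (ht : t₀ ≤ t) {e : Fin N → Plane}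
    (he : ∀ i, HasDerivWithinAt (d i) (e i) (Set.Ici t₀) t) :
    HasDerivWithinAt
      (fun s => loopLyap K w (fun i => (S s).x i - xs i) (fun i j => (S s).y i j - (S s).x j)
        (fun i => σ • ((S s).x i - (S s).xhat i)) (fun i => d i s - (S s).zhat i))
      (loopLyapDeriv G A K w θ σ (fun i => (S t).x i - xs i)
        (fun i j => (S t).y i j - (S t).x j) (fun i => σ • ((S t).x i - (S t).xhat i))
        (fun i => d i t - (S t).zhat i) e) (Set.Ici t₀) t := by
  have hvel (i : Fin N) : piControl G (S t) i + d i t =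
      G.errorVel (fun i => (S t).x i - xs i) (fun i j => (S t).y i j - (S t).x j)
        (fun i => d i t - (S t).zhat i) i := by
    -- Stationarity at the equilibrium removes the affine part of the gradient.
    have h1 : G.lin i = -G.hess i xs := eq_neg_of_add_eq_zero_right ((G.isNash_iff xs).1 hxs i)
    have h2 : (S t).y i = (fun i => (S t).x i - xs i) + (fun j => (S t).y i j - (S t).x j) +
        xs := by
      funext j
      simp
    rw [piControl, G.partialGrad_eq, h1]
    conv_lhs => rw [h2]
    rw [map_add, map_add, SensorGame.errorVel]
    abel
  have hξ (i : Fin N) : HasDerivWithinAt (fun s => (S s).x i - xs i)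
      (G.errorVel (fun i => (S t).x i - xs i) (fun i j => (S t).y i j - (S t).x j)
        (fun i => d i t - (S t).zhat i) i) (Set.Ici t₀) t := by
    rw [← hvel]
    exact (hS.x_eq t ht i).sub_const (xs i)
  have hη (i j : Fin N) : HasDerivWithinAt (fun s => (S s).y i j - (S s).x j)
      (-((θ * K.thetaBar i j) • A.pinnedLap j (fun k => (S t).y k j - (S t).x j) i) -
        G.errorVel (fun i => (S t).x i - xs i) (fun i j => (S t).y i j - (S t).x j)
        (fun i => d i t - (S t).zhat i) j) (Set.Ici t₀) t := by
    rw [← hvel]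
    simp only [CommGraph.pinnedLap, sub_sub_sub_cancel_right]
    exact (hS.y_eq t ht i j).sub (hS.x_eq t ht j)
  have hp (i : Fin N) : HasDerivWithinAt (fun s => σ • ((S s).x i - (S s).xhat i))
      (σ • ((d i t - (S t).zhat i) - K.k₁ i • (σ • ((S t).x i - (S t).xhat i))))
      (Set.Ici t₀) t := by
    -- The control cancels between `x` and `x̂`, so the observer error is driven by `d - ẑ` alone.
    refine (((hS.x_eq t ht i).sub (hS.xhat_eq t ht i)).const_smul σ).congr_deriv ?_
    rw [smul_smul, mul_comm σ]
    congr 1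
    abel
  have hq (i : Fin N) : HasDerivWithinAt (fun s => d i s - (S s).zhat i)
      (e i - (σ * K.k₂ i) • (σ • ((S t).x i - (S t).xhat i))) (Set.Ici t₀) t := by
    refine ((he i).sub (hS.zhat_eq t ht i)).congr_deriv ?_
    rw [smul_smul]
    congr 2
    ring
  unfold loopLyap loopLyapDeriv
  refine ((HasDerivWithinAt.fun_sum fun i _ => (hξ i).norm_sq.const_mul (w i)).add
    (HasDerivWithinAt.fun_sum fun i _ => HasDerivWithinAt.fun_sum fun j _ =>
      (hη i j).norm_sq.const_mul _)).add (HasDerivWithinAt.fun_sum fun i _ => ?_)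
  exact (((hp i).norm_sq.const_mul _).sub (((hp i).inner ℝ (hq i)).const_mul 2)).add
    ((hq i).norm_sq.const_mul _)

theorem norm_errorVec_sq_le_errSq (hσ : 1 ≤ σ) (t : ℝ) :
    ‖errorVec xs d S t‖ ^ 2 ≤ errSq (fun i => (S t).x i - xs i)
      (fun i j => (S t).y i j - (S t).x j) (fun i => σ • ((S t).x i - (S t).xhat i))
      (fun i => d i t - (S t).zhat i) := by
  have h : ∑ i, ‖(S t).x i - (S t).xhat i‖ ^ 2 ≤
      ∑ i, ‖σ • ((S t).x i - (S t).xhat i)‖ ^ 2 := by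
    gcongr with i
    rw [norm_smul, Real.norm_eq_abs, abs_of_pos (by linarith)]
    exact le_mul_of_one_le_left (norm_nonneg _) hσ
  rw [PiLp.norm_sq_eq_of_L2, errSq, Finset.sum_add_distrib]
  simp only [errorVec, Fintype.sum_sum_type, Fintype.sum_prod_type, Sum.elim_inl, Sum.elim_inr]
  linarith

end ClosedLoop

/-! ### Choice of gains and the ultimate bound -/

theorem corollary2 (N : ℕ) (hN : 2 ≤ N)
    (G : SensorGame N) (A : CommGraph N) (hA : A.toSimpleGraph.Connected) (K : FixedGains N)
    (t₀ : ℝ) (d : Fin N → ℝ → Plane)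
    (hd : ∀ i, ContDiffOn ℝ 1 (d i) (Set.Ici t₀))
    (hd' : ∀ i, ∃ M : ℝ, ∀ t, t₀ ≤ t → ‖derivWithin (d i) (Set.Ici t₀) t‖ ≤ M) :
    (∃! xs : Fin N → Plane, G.IsNash xs) ∧
    ∀ xs : Fin N → Plane, G.IsNash xs →
      ∃ θs : ℝ, 0 < θs ∧ ∀ v₁ : ℝ, 0 < v₁ → ∃ σs : ℝ, 0 < σs ∧
        ∀ θ : ℝ, θs < θ → ∀ σ : ℝ, σs < σ →
          ∀ S : ℝ → LoopState N, IsTrajectory G A K d t₀ θ σ S →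
            ∃ T : ℝ, t₀ ≤ T ∧ ∀ t : ℝ, T < t → ‖errorVec xs d S t‖ ≤ v₁ := by
  refine ⟨G.existsUnique_isNash, fun xs hxs => ?_⟩
  choose M hM using hd'
  obtain ⟨w, hw, hwle⟩ := G.exists_weights
  obtain ⟨θs, σ₀, D, hθs, hσ₀, hD, hder⟩ := exists_loopLyapDeriv_le G A K hN hA hw hwle M
  obtain ⟨B, hB, hBle⟩ := exists_loopLyap_le K w
  obtain ⟨m, hm, hmle⟩ := exists_le_loopLyap K hw hN
  -- `σ > 1` makes the scaled error dominate the true one, `σ₀` gives the decay estimate, and the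
  -- last bound puts the rest level `BD/σ` below `m v₁²`.
  refine ⟨θs, hθs, fun v₁ hv₁ => ⟨max (max σ₀ 1) (B * D / (m * v₁ ^ 2)), by positivity,
    fun θ hθ σ hσ S hS => ?_⟩⟩
  have hσ₁ : 1 < σ := ((le_max_right _ _).trans (le_max_left _ _)).trans_lt hσ
  have hσ₂ : σ₀ < σ := ((le_max_left _ _).trans (le_max_left _ _)).trans_lt hσ
  have hσ₃ : B * D / (m * v₁ ^ 2) < σ := (le_max_right _ _).trans_lt hσ
  have hb : D / σ / (1 / B) < m * v₁ ^ 2 := by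
    rw [div_lt_iff₀ (by positivity)] at hσ₃
    rw [div_div, div_lt_iff₀ (by positivity)]
    field_simp
    linarith
  obtain ⟨T, hT, hTle⟩ := exists_forall_gt_le_of_hasDerivWithinAt_le (one_div_pos.2 hB)
    (fun t ht => hS.hasDerivWithinAt_loopLyap hxs w ht fun i =>
      ((hd i).differentiableOn one_ne_zero t ht).hasDerivWithinAt)
    (fun t ht => by
      refine (hder θ hθ σ hσ₂ _ _ _ _ _ fun i => hM i t ht).trans ?_
      gcongr
      rw [neg_mul, neg_le_neg_iff, one_div, inv_mul_le_iff₀ hB]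
      exact hBle _ _ _ _) hb
  refine ⟨T, hT, fun t ht => ?_⟩
  have h1 := (hmle _ _ _ _).trans (hTle t ht)
  have h2 := (norm_errorVec_sq_le_errSq hσ₁.le t).trans (le_of_mul_le_mul_left h1 hm)
  exact (sq_le_sq₀ (norm_nonneg _) hv₁.le).1 h2
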